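/- Let $F$ be a field with algebraic closure $\overline F$. For square matrices $A\in F^{r\times r}$ and $B\in F^{s\times s}$ let $$C(A,B)=\{X\in F^{r\times s} : AX=XB\},$$ a subspace of $F^{r\times s}$, and let $c_A(t)=\det(tI-A)$ be the characteristic polynomial of $A$. Let $N_n$ be the $n\times n$ matrix with entry $1$ in the positions $(i,i+1)$ for $1\le i<n$ and all other entries $0$, and for a partition $\lambda=(\lambda_1\ge\lambda_2\ge\cdots)$ let $N_\lambda=N_{\lambda_1}\oplus N_{\lambda_2}\oplus\cdots$ be the block diagonal matrix with diagonal blocks $N_{\lambda_1},N_{\lambda_2},\dots$ **Theorem 2.7.** Let $A\in F^{r\times r}$ and $B\in F^{s\times s}$, and let $\zeta_1,\dots,\zeta_m$ be the distinct roots of $\gcd(c_A(t),c_B(t))$ in $\overline F$. For each $i$ let $\alpha_i$ and $\beta_i$ be the partitions formed by the sizes of the Jordan blocks, over $\overline F$, of $A$ and of $B$ respectively, associated with the generalized $\zeta_i$-eigenspace; that is, in suitable bases the restrictions of $A$ and of $B$ to their generalized $\zeta_i$-eigenspaces have the matrices $\zeta_iI+N_{\alpha_i}$ and $\zeta_iI+N_{\beta_i}$.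 Then $$\dim_F C(A,B)=\sum_{i=1}^m \dim_F C(N_{\alpha_i},N_{\beta_i}).$$ -/

import Mathlib

/-- The intertwining code `C(A, B)`: the space of matrices `X` with `A X = X B`. -/
def intertwiningCode {F : Type*} [Field F] {m n : Type*} [Fintype m] [Fintype n]
    (A : Matrix m m F) (B : Matrix n n F) : Submodule F (Matrix m n F) where
  carrier := {X | A * X = X * B}
  add_mem' := by
    intro X Y hX hY
    simp only [Set.mem_ofPred_eq] at hX hY ⊢
    rw [Matrix.mul_add, Matrix.add_mul, hX, hY]
  zero_mem' := by simp
  smul_mem' := by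
    intro c X hX
    simp only [Set.mem_ofPred_eq] at hX ⊢
    rw [Matrix.mul_smul, Matrix.smul_mul, hX]

/-- The parts of a partition, listed as a weakly decreasing sequence of positive integers. -/
def partitionParts {k : ℕ} (p : k.Partition) : List ℕ :=
  p.parts.sort (· ≥ ·)

/-- Positions of the rows (and columns) of a block diagonal matrix whose diagonal blocks have the
parts of `p` as their sizes: the index of a block, and a position inside that block. -/
abbrev BlockIndex {k : ℕ} (p : k.Partition) : Type :=
  (i : Fin (partitionParts p).length) × Fin ((partitionParts p).get i)

/-- The `n × n` nilpotent matrix `N_n`, with ones just above the diagonal and zeros elsewhere. -/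
def nilpotentBlock (F : Type*) [Field F] (n : ℕ) : Matrix (Fin n) (Fin n) F :=
  Matrix.of fun i j => if (i : ℕ) + 1 = (j : ℕ) then 1 else 0

/-- The nilpotent matrix `N_p = N_{p_1} ⊕ N_{p_2} ⊕ ⋯` of a partition `p = (p_1, p_2, …)`. -/
def nilpotentMatrix (F : Type*) [Field F] {k : ℕ} (p : k.Partition) :
    Matrix (BlockIndex p) (BlockIndex p) F :=
  Matrix.blockDiagonal' fun i => nilpotentBlock F ((partitionParts p).get i)

/-- The restriction of an endomorphism to its generalized `z`-eigenspace. -/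
noncomputable def restrictGenEigenspace {K V : Type*} [Field K] [AddCommGroup V] [Module K V]
    (T : Module.End K V) (z : K) : Module.End K (T.maxGenEigenspace z) :=
  LinearMap.restrict T (T.mapsTo_maxGenEigenspace_of_comm (Commute.refl T) z)

/-- The sizes of the Jordan blocks of the square matrix `A` associated with its generalized
`z`-eigenspace form the partition `p`: in some basis of that eigenspace, the restriction of `A`
to it has the matrix `z I + N_p`. -/
def IsJordanPartition {K : Type*} [Field K] {n : Type*} [Fintype n] [DecidableEq n]
    (A : Matrix n n K) (z : K) {k : ℕ} (p : k.Partition) : Prop :=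
  ∃ b : Module.Basis (BlockIndex p) K (Module.End.maxGenEigenspace (Matrix.toLin' A) z),
    LinearMap.toMatrix b b (restrictGenEigenspace (Matrix.toLin' A) z) =
      Matrix.scalar (BlockIndex p) z + nilpotentMatrix K p

open Polynomial DirectSum in
/-- A nilpotent endomorphism has a basis made of chains. -/
theorem exists_chain_basis {K V : Type*} [Field K] [AddCommGroup V] [Module K V] [Module.Finite K V]
    (f : Module.End K V) (hf : IsNilpotent f) :
    ∃ (d : ℕ) (k : Fin d → ℕ) (b : Module.Basis ((i : Fin d) × Fin (k i)) K V),
      ∀ i (j : Fin (k i)), f (b ⟨i, j⟩) =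
        if h : (j : ℕ) = 0 then 0 else b ⟨i, ⟨j - 1, by omega⟩⟩ := by
  obtain ⟨N, hN⟩ := hf
  have htor : Module.IsTorsion' (Module.AEval' f) (Submonoid.powers (X : K[X])) := by
    intro x
    refine ⟨⟨X ^ N, N, rfl⟩, ?_⟩
    obtain ⟨v, rfl⟩ := (Module.AEval'.of f).surjective x
    change (X ^ N : K[X]) • (Module.AEval'.of f v) = 0
    rw [Module.AEval'.X_pow_smul_of, hN]
    simp
  obtain ⟨d, k, ⟨e⟩⟩ := Module.torsion_by_prime_power_decomposition
    (Polynomial.irreducible_X (R := K)) htor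
  let c : (i : Fin d) → Module.Basis (Fin (k i)) K (K[X] ⧸ K[X] ∙ (X ^ (k i) : K[X])) := fun i =>
    (AdjoinRoot.powerBasis' (monic_X_pow (R := K) (k i))).basis.reindex
      ((finCongr (natDegree_X_pow (k i))).trans Fin.revPerm)
  have hc : ∀ i (j : Fin (k i)), c i j =
      Submodule.Quotient.mk ((X : K[X]) ^ (k i - 1 - (j : ℕ))) := by
    intro i j
    change (Module.Basis.reindex (AdjoinRoot.powerBasis' (monic_X_pow (R := K) (k i))).basis _) j = _
    refine (Module.Basis.reindex_apply (AdjoinRoot.powerBasis' (monic_X_pow (R := K) (k i))).basis _ j).trans ?_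
    refine ((AdjoinRoot.powerBasis' (monic_X_pow (R := K) (k i))).basis_eq_pow _).trans ?_
    have : (k i - 1 - (j : ℕ)) = k i - (j + 1) := by omega
    rw [this]
    rfl
  let e' := (Module.AEval'.of f).trans (e.restrictScalars K)
  let b : Module.Basis ((i : Fin d) × Fin (k i)) K V := (DFinsupp.basis c).map e'.symm
  refine ⟨d, k, b, ?_⟩
  have hb : ∀ i j, b ⟨i, j⟩ = e'.symm (DirectSum.of (fun i => K[X] ⧸ K[X] ∙ (X ^ (k i) : K[X])) i (c i j)) := by
    intro i j
    simp only [b, Module.Basis.map_apply]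
    congr 1
    apply (DFinsupp.basis c).repr.injective
    rw [Module.Basis.repr_self]
    ext ⟨i', j'⟩
    change _ = (c i').repr (DirectSum.of (fun i => K[X] ⧸ K[X] ∙ (X ^ (k i) : K[X])) i (c i j) i') j'
    by_cases h : i = i'
    · subst h
      rw [DirectSum.of_eq_same, Module.Basis.repr_self]
      simp [Finsupp.single_apply]
    · rw [DirectSum.of_eq_of_ne _ _ _ (Ne.symm h), map_zero, Finsupp.single_apply, if_neg]
      · rfl
      · simp [h]
  have hX : ∀ x, f (e'.symm x) = e'.symm ((X : K[X]) • x) := by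
    intro x
    obtain ⟨v, rfl⟩ := e'.surjective x
    rw [LinearEquiv.symm_apply_apply, LinearEquiv.eq_symm_apply]
    change e (Module.AEval'.of f (f v)) = (X : K[X]) • e (Module.AEval'.of f v)
    rw [← map_smul, Module.AEval'.X_smul_of]
  intro i j
  rw [hb, hX, hc]
  have hsm : ∀ p : K[X], (X : K[X]) • (DirectSum.of (fun i => K[X] ⧸ K[X] ∙ (X ^ (k i) : K[X])) i
      (Submodule.Quotient.mk p)) = DirectSum.of (fun i => K[X] ⧸ K[X] ∙ (X ^ (k i) : K[X])) i
      (Submodule.Quotient.mk (X * p)) := by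
    intro p
    rw [← DirectSum.lof_eq_of K[X], ← map_smul, ← Submodule.Quotient.mk_smul, smul_eq_mul,
      DirectSum.lof_eq_of]
  rw [hsm, ← pow_succ']
  split_ifs with h
  · have : k i - 1 - (j : ℕ) + 1 = k i := by omega
    rw [this, (Submodule.Quotient.mk_eq_zero _).2 (Submodule.mem_span_singleton_self _)]
    simp
  · rw [hb, hc]
    have : k i - 1 - (j : ℕ) + 1 = k i - 1 - ((j : ℕ) - 1) := by omega
    rw [this]

/-- Dropping empty chains and sorting the others by length yields a partition. -/
theorem exists_partition_reindex {d : ℕ} (k : Fin d → ℕ) :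
    ∃ (n : ℕ) (p : n.Partition) (g : BlockIndex p ≃ ((i : Fin d) × Fin (k i))),
      ∀ x y : BlockIndex p, ((g x).2 : ℕ) = x.2 ∧ ((g x).1 = (g y).1 ↔ x.1 = y.1) := by
  let S : Multiset ℕ := Finset.univ.val.map k
  let p : S.sum.Partition := Nat.Partition.ofMultiset S
  let l := partitionParts p
  have hl : (l : Multiset ℕ) = Finset.univ.val.map (fun i : {i // k i ≠ 0} => k i) := by
    simp only [l, partitionParts, Multiset.sort_eq, p, Nat.Partition.ofMultiset_parts, S]
    rw [Multiset.filter_map]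
    have h2 : Finset.univ.val.filter (fun i => k i ≠ 0) =
        Multiset.map Subtype.val (Finset.univ : Finset {i // k i ≠ 0}).val := by
      have h3 : Finset.univ.filter (fun i => k i ≠ 0) =
          (Finset.univ : Finset {i // k i ≠ 0}).map (Function.Embedding.subtype _) := by
        ext i
        simp
      exact congrArg Finset.val h3
    change Multiset.map k (Finset.univ.val.filter (fun i => k i ≠ 0)) = _
    rw [h2, Multiset.map_map]
    rfl
  have hcard : ∀ n, Fintype.card {i : Fin l.length // l.get i = n} =
      Fintype.card {i : {i // k i ≠ 0} // k i = n} := by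
    intro n
    have h0 : (l : Multiset ℕ) = Multiset.map l.get Finset.univ.val := by
      simp
    have h1 := congrArg (Multiset.count n) (h0.symm.trans hl)
    rw [Multiset.count_map, Multiset.count_map] at h1
    rw [Fintype.card_subtype, Fintype.card_subtype]
    simp only [eq_comm (a := n)] at h1
    exact h1
  let σ : Fin l.length ≃ {i // k i ≠ 0} :=
    (Equiv.sigmaFiberEquiv (fun i : Fin l.length => l.get i)).symm.trans
      ((Equiv.sigmaCongrRight fun n => Fintype.equivOfCardEq (hcard n)).trans
        (Equiv.sigmaFiberEquiv (fun i : {i // k i ≠ 0} => k i)))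
  have hσ : ∀ i, l.get i = k (σ i) := by
    intro i
    exact ((Fintype.equivOfCardEq (hcard (l.get i))) ⟨i, rfl⟩).2.symm
  let g : BlockIndex p → ((i : Fin d) × Fin (k i)) := fun x => ⟨(σ x.1).1, Fin.cast (hσ x.1) x.2⟩
  have hg : Function.Bijective g := by
    constructor
    · rintro ⟨i, a⟩ ⟨j, c⟩ h
      simp only [g, Sigma.mk.injEq] at h
      obtain ⟨h1, h2⟩ := h
      obtain rfl := σ.injective (Subtype.ext h1)
      simpa using h2
    · rintro ⟨i, a⟩
      have hi : k i ≠ 0 := by have := a.2; omega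
      refine ⟨⟨σ.symm ⟨i, hi⟩, Fin.cast ((congrArg (fun q => k q.1) (σ.apply_symm_apply ⟨i, hi⟩)).symm.trans
        (hσ (σ.symm ⟨i, hi⟩)).symm) a⟩, ?_⟩
      have hh : (σ (σ.symm ⟨i, hi⟩)).1 = i := by simp
      refine Sigma.ext hh ?_
      simp only [g]
      refine (Fin.heq_ext_iff (congrArg k hh)).2 ?_
      simp
  refine ⟨_, p, Equiv.ofBijective g hg, fun x y => ⟨rfl, ?_⟩⟩
  simp only [Equiv.ofBijective_apply, g, Subtype.val_inj, σ.injective.eq_iff]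

/-- The notion is never void: at every `z` every square matrix has such a partition
(the partition of `0` if `z` is not an eigenvalue). -/
theorem exists_isJordanPartition {K : Type*} [Field K] {n : Type*} [Fintype n] [DecidableEq n]
    (A : Matrix n n K) (z : K) : ∃ (k : ℕ) (p : k.Partition), IsJordanPartition A z p := by
  let T := Matrix.toLin' A
  let f := restrictGenEigenspace T z - algebraMap K _ z
  have hf : IsNilpotent f := by
    exact Module.End.isNilpotent_restrict_maxGenEigenspace_sub_algebraMap T z
  obtain ⟨d, k, b, hb⟩ := exists_chain_basis f hf
  obtain ⟨m, p, g, hg⟩ := exists_partition_reindex k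
  refine ⟨m, p, b.reindex g.symm, ?_⟩
  have : restrictGenEigenspace T z = algebraMap K _ z + f := by
    apply LinearMap.ext
    intro v
    simp only [f, LinearMap.add_apply, LinearMap.sub_apply, add_sub_cancel]
  change LinearMap.toMatrix _ _ (restrictGenEigenspace T z) = _
  rw [this, map_add]
  congr 1
  · ext x y
    rw [LinearMap.toMatrix_apply, Module.algebraMap_end_apply, map_smul, Module.Basis.repr_self]
    simp [Finsupp.single_apply, Matrix.diagonal_apply, eq_comm]
  · ext x y
    obtain ⟨i, a⟩ := x
    obtain ⟨j, c⟩ := y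
    rw [LinearMap.toMatrix_apply, Module.Basis.reindex_apply, Equiv.symm_symm]
    have h1 := hb (g ⟨j, c⟩).1 (g ⟨j, c⟩).2
    rw [Sigma.eta] at h1
    have h2 := (hg ⟨j, c⟩ ⟨j, c⟩).1
    have h3 := hg ⟨i, a⟩ ⟨j, c⟩
    rw [h1, Module.Basis.repr_reindex_apply, Equiv.symm_symm]
    have hext : ∀ u v : (i : Fin d) × Fin (k i), u = v ↔ u.1 = v.1 ∧ (u.2 : ℕ) = v.2 := by
      rintro ⟨u1, u2⟩ ⟨v1, v2⟩
      constructor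
      · intro h
        rw [h]
        exact ⟨rfl, rfl⟩
      · rintro ⟨h, h'⟩
        simp only at h
        subst h
        exact congrArg (Sigma.mk u1) (Fin.ext h')
    obtain ⟨h3, h4⟩ := h3
    simp only at h2 h3 h4
    by_cases hij : i = j
    · subst hij
      have h5 : nilpotentMatrix K p ⟨i, a⟩ ⟨i, c⟩ = if (a : ℕ) + 1 = (c : ℕ) then 1 else 0 := by
        rw [nilpotentMatrix, Matrix.blockDiagonal'_apply_eq]
        rfl
      rw [h5]
      by_cases h6 : ((g ⟨i, c⟩).2 : ℕ) = 0
      · rw [dif_pos h6, if_neg (by omega)]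
        simp
      · rw [dif_neg h6, Module.Basis.repr_self, Finsupp.single_apply]
        refine if_congr ?_ rfl rfl
        rw [hext]
        simp only [h4.2, true_and, h2, h3]
        omega
    · rw [nilpotentMatrix, Matrix.blockDiagonal'_apply_ne _ _ _ hij]
      by_cases h6 : ((g ⟨j, c⟩).2 : ℕ) = 0
      · rw [dif_pos h6]
        simp
      · rw [dif_neg h6, Module.Basis.repr_self, Finsupp.single_apply, if_neg]
        rw [hext]
        rintro ⟨h7, -⟩
        exact hij (h4.1 h7.symm)

open Module

/-! `C(A, B)` is the kernel of `X ↦ A X - X B`, a linear system with coefficients in `F`, so its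
dimension does not change over the algebraic closure `K`. Over `K`, a solution is a linear map `φ :
W → V` with `S φ = φ T`, where `S` and `T` are the endomorphisms given by `A` and `B`. Then `(S -
z)^k φ = φ (T - z)^k`, so `φ` sends each generalized eigenspace of `T` into that of `S` for the same
`z`.

Since `W` is the direct sum of these eigenspaces, `φ` amounts to an independent choice of an
intertwiner on each (`restrictIntertwiners` is bijective). When `z` is not a common root, source or
target vanishes and there is nothing to choose. At `ζ i` the two restrictions are `ζ i` plus
nilpotent Jordan matrices; the scalar cancels, and the nilpotent matrices have entries 0 and 1, so
the dimension can be computed over `F` again. -/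

/-! ### Extension of scalars. -/

/-- If two endomorphisms have, in suitable bases, the same matrix up to extension of scalars, then
their kernels have the same dimension. -/
theorem finrank_ker_eq_of_repr_algebraMap {F K V V' ι : Type*} [Field F] [Field K] [Algebra F K]
    [AddCommGroup V] [Module F V] [AddCommGroup V'] [Module K V'] (v : Basis ι F V)
    (v' : Basis ι K V') (f : V →ₗ[F] V) (f' : V' →ₗ[K] V')
    (h : ∀ i j, v'.repr (f' (v' j)) i = algebraMap F K (v.repr (f (v j)) i)) :
    finrank F (LinearMap.ker f) = finrank K (LinearMap.ker f') := by
  -- The bases identify `K ⊗ V` with `V'`, and by `h` this identification carries `f.baseChange K`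
  -- to `f'`.
  let θ := (v.baseChange K).equiv v' (Equiv.refl ι)
  have hθ : θ.toLinearMap ∘ₗ f.baseChange K = f' ∘ₗ θ.toLinearMap := by
    refine (v.baseChange K).ext fun j => v'.repr.injective (Finsupp.ext fun i => ?_)
    have hr : ∀ x, v'.repr (θ x) = (v.baseChange K).repr x := by
      intro x
      simp [θ, Basis.equiv]
    simp only [LinearMap.comp_apply, LinearEquiv.coe_coe, hr]
    rw [show θ ((v.baseChange K) j) = v' j from Basis.equiv_apply _ _ _ _, h, Basis.baseChange_apply,
      LinearMap.baseChange_tmul, Basis.baseChange_repr_tmul]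
    simp [Algebra.smul_def]
  have hker : LinearMap.ker (f.baseChange K) =
      (LinearMap.ker f').comap θ.toLinearMap := by
    rw [← LinearMap.ker_comp, ← hθ, LinearMap.ker_comp_of_ker_eq_bot _ θ.ker]
  -- `K` is flat over `F`, so tensoring with `K` commutes with taking the kernel.
  rw [← Module.finrank_baseChange (R := K) (S := F) (M' := LinearMap.ker f),
    (LinearMap.tensorKerEquiv K K f).finrank_eq]
  change finrank K (LinearMap.ker (f.baseChange K)) = _
  rw [hker, Submodule.comap_equiv_eq_map_symm, LinearEquiv.finrank_map_eq]

/-- The linear map `X ↦ A X - X B`. -/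
def sylvesterMap {F m n : Type*} [Field F] [Fintype m] [Fintype n]
    (A : Matrix m m F) (B : Matrix n n F) : Matrix m n F →ₗ[F] Matrix m n F where
  toFun X := A * X - X * B
  map_add' X Y := by rw [Matrix.mul_add, Matrix.add_mul]; abel
  map_smul' c X := by simp [smul_sub]

theorem ker_sylvesterMap {F m n : Type*} [Field F] [Fintype m] [Fintype n]
    (A : Matrix m m F) (B : Matrix n n F) :
    LinearMap.ker (sylvesterMap A B) = intertwiningCode A B := by
  ext X
  exact sub_eq_zero

/-- The dimension of an intertwining code is invariant under extension of the field. -/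
theorem finrank_intertwiningCode_map {F m n : Type*} (K : Type*) [Field F] [Field K] [Algebra F K]
    [Fintype m] [Fintype n] (A : Matrix m m F) (B : Matrix n n F) :
    finrank K (intertwiningCode (A.map (algebraMap F K)) (B.map (algebraMap F K))) =
      finrank F (intertwiningCode A B) := by
  classical
  rw [← ker_sylvesterMap, ← ker_sylvesterMap]
  refine (finrank_ker_eq_of_repr_algebraMap (Matrix.stdBasis F m n) (Matrix.stdBasis K m n)
    _ _ ?_).symm
  have hr : ∀ (E : Type _) [Field E] (X : Matrix m n E) (i : m × n),
      (Matrix.stdBasis E m n).repr X i = X i.1 i.2 := by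
    intro E _ X i
    simp [Matrix.stdBasis]
  have hr' : ∀ (X : Matrix m n F) (i : m × n),
      (Matrix.stdBasis F m n).repr X i = X i.1 i.2 := by
    intro X i
    simp [Matrix.stdBasis]
  rintro ⟨i, j⟩ ⟨k, l⟩
  -- The standard basis over `K` is the image of the one over `F`, so every coordinate of its image
  -- under the Sylvester map comes from `F`.
  have hs : Matrix.single k l (1 : K) = (Matrix.single k l (1 : F)).map (algebraMap F K) := by
    simp
  rw [hr, hr', Matrix.stdBasis_eq_single, Matrix.stdBasis_eq_single, hs]
  simp only [sylvesterMap, LinearMap.coe_mk, AddHom.coe_mk]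
  rw [← Matrix.map_mul, ← Matrix.map_mul, Matrix.sub_apply, Matrix.sub_apply, map_sub]
  rfl

/-! ### Coordinate-free intertwiners. -/

/-- The linear maps `φ` with `S φ = φ T`. -/
def intertwiners {K V W : Type*} [Field K] [AddCommGroup V] [Module K V] [AddCommGroup W]
    [Module K W] (S : Module.End K V) (T : Module.End K W) : Submodule K (W →ₗ[K] V) where
  carrier := {φ | S ∘ₗ φ = φ ∘ₗ T}
  add_mem' {φ ψ} (hφ : _ = _) (hψ : _ = _) := by
    change S ∘ₗ (φ + ψ) = (φ + ψ) ∘ₗ T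
    rw [LinearMap.comp_add, LinearMap.add_comp, hφ, hψ]
  zero_mem' := by simp
  smul_mem' c φ (hφ : _ = _) := by
    change S ∘ₗ (c • φ) = (c • φ) ∘ₗ T
    rw [LinearMap.comp_smul, LinearMap.smul_comp, hφ]

theorem mem_intertwiners {K V W : Type*} [Field K] [AddCommGroup V] [Module K V] [AddCommGroup W]
    [Module K W] {S : Module.End K V} {T : Module.End K W} {φ : W →ₗ[K] V} :
    φ ∈ intertwiners S T ↔ S ∘ₗ φ = φ ∘ₗ T := Iff.rfl

theorem finrank_intertwiners_eq_intertwiningCode {K V W m n : Type*} [Field K] [AddCommGroup V]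
    [Module K V] [AddCommGroup W] [Module K W] [Fintype m] [Fintype n] [DecidableEq m]
    [DecidableEq n] (v : Basis m K V) (w : Basis n K W) (S : Module.End K V)
    (T : Module.End K W) :
    finrank K (intertwiners S T) =
      finrank K (intertwiningCode (LinearMap.toMatrix v v S) (LinearMap.toMatrix w w T)) := by
  have : intertwiners S T = (intertwiningCode (LinearMap.toMatrix v v S)
      (LinearMap.toMatrix w w T)).comap (LinearMap.toMatrix w v).toLinearMap := by
    ext φ
    change S ∘ₗ φ = φ ∘ₗ T ↔ LinearMap.toMatrix v v S * LinearMap.toMatrix w v φ =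
      LinearMap.toMatrix w v φ * LinearMap.toMatrix w w T
    rw [← LinearMap.toMatrix_comp w v v, ← LinearMap.toMatrix_comp w w v,
      (LinearMap.toMatrix w v).injective.eq_iff]
  rw [this, Submodule.comap_equiv_eq_map_symm, LinearEquiv.finrank_map_eq]

/-- A scalar `z` commutes with `X`, so the same term appears on both sides of the equation and
cancels. -/
theorem intertwiningCode_scalar_add {K m n : Type*} [Field K] [Fintype m] [Fintype n]
    [DecidableEq m] [DecidableEq n] (z : K) (A : Matrix m m K) (B : Matrix n n K) :
    intertwiningCode (Matrix.scalar m z + A) (Matrix.scalar n z + B) = intertwiningCode A B := by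
  ext X
  change (_ + A) * X = X * (_ + B) ↔ A * X = X * B
  have : Matrix.scalar m z * X = X * Matrix.scalar n z := by
    ext i j
    simp [mul_comm]
  rw [Matrix.add_mul, Matrix.mul_add, this, add_right_inj]

theorem nilpotentMatrix_map (F K : Type*) [Field F] [Field K] [Algebra F K] {k : ℕ}
    (p : k.Partition) :
    (nilpotentMatrix F p).map (algebraMap F K) = nilpotentMatrix K p := by
  rw [nilpotentMatrix, Matrix.blockDiagonal'_map _ _ (map_zero _), nilpotentMatrix]
  congr 1
  ext i a c
  simp [nilpotentBlock, apply_ite (algebraMap F K)]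

/-! ### Decomposition along generalized eigenspaces. -/

/-- Intertwiners respect generalized eigenspaces. -/
theorem mapsTo_maxGenEigenspace_of_mem_intertwiners {K V W : Type*} [Field K] [AddCommGroup V]
    [Module K V] [AddCommGroup W] [Module K W] {S : Module.End K V} {T : Module.End K W}
    {φ : W →ₗ[K] V} (hφ : φ ∈ intertwiners S T) (z : K) {x : W}
    (hx : x ∈ T.maxGenEigenspace z) : φ x ∈ S.maxGenEigenspace z := by
  rw [Module.End.mem_maxGenEigenspace] at hx ⊢
  obtain ⟨k, hk⟩ := hx
  refine ⟨k, ?_⟩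
  have h1 : ∀ y, (S - z • 1) (φ y) = φ ((T - z • 1) y) := by
    intro y
    have := LinearMap.congr_fun (mem_intertwiners.1 hφ) y
    simp only [LinearMap.comp_apply] at this
    simp [this]
  have h2 : ∀ (k : ℕ) (y : W), ((S - z • 1) ^ k) (φ y) = φ (((T - z • 1) ^ k) y) := by
    intro k
    induction k with
    | zero => simp
    | succ k ih =>
      intro y
      rw [pow_succ, pow_succ, Module.End.mul_apply, Module.End.mul_apply, h1, ih]
  rw [h2, hk, map_zero]

/-- Restriction of intertwiners to finitely many generalized eigenspaces. -/
def restrictIntertwiners {K V W ι : Type*} [Field K] [AddCommGroup V]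
    [Module K V] [AddCommGroup W] [Module K W] (S : Module.End K V) (T : Module.End K W)
    (ζ : ι → K) : intertwiners S T →ₗ[K]
      ((i : ι) → intertwiners (restrictGenEigenspace S (ζ i)) (restrictGenEigenspace T (ζ i))) where
  toFun φ i := ⟨φ.1.restrict fun _ hx => mapsTo_maxGenEigenspace_of_mem_intertwiners φ.2 (ζ i) hx,
    LinearMap.ext fun x => Subtype.ext (LinearMap.congr_fun (mem_intertwiners.1 φ.2) x.1)⟩
  map_add' _ _ := rfl
  map_smul' _ _ := rfl

/-- The generalized eigenspaces of `T` span, so it suffices that `φ` vanishes on each: for `z` among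
the `ζ i` its restriction is zero, and for other `z` its source or target is zero. -/
theorem restrictIntertwiners_injective {K V W ι : Type*} [Field K] [AddCommGroup V]
    [Module K V] [AddCommGroup W] [Module K W] (S : Module.End K V) (T : Module.End K W)
    (ζ : ι → K) (hT : ⨆ z, T.maxGenEigenspace z = ⊤)
    (hζ : ∀ z ∉ Set.range ζ, S.maxGenEigenspace z = ⊥ ∨ T.maxGenEigenspace z = ⊥) :
    Function.Injective (restrictIntertwiners S T ζ) := by
  rw [← LinearMap.ker_eq_bot, LinearMap.ker_eq_bot']
  intro φ h
  refine Subtype.ext ?_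
  rw [ZeroMemClass.coe_zero, ← LinearMap.ker_eq_top, eq_top_iff, ← hT]
  refine iSup_le fun z x hx => ?_
  rw [LinearMap.mem_ker]
  by_cases hz : z ∈ Set.range ζ
  · obtain ⟨i, rfl⟩ := hz
    have h1 := LinearMap.congr_fun (congrArg Subtype.val (congrFun h i)) ⟨x, hx⟩
    exact congrArg Subtype.val h1
  · have h1 := mapsTo_maxGenEigenspace_of_mem_intertwiners φ.2 z hx
    obtain h0 | h0 := hζ z hz
    · rwa [h0, Submodule.mem_bot] at h1
    · rw [h0, Submodule.mem_bot] at hx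
      rw [hx, map_zero]

/-- The prescribed pieces are glued along the direct sum decomposition of `W`, with zero on the
eigenspaces outside the family `ζ`. -/
theorem restrictIntertwiners_surjective {K V W ι : Type*} [Field K] [AddCommGroup V]
    [Module K V] [AddCommGroup W] [Module K W] [Fintype ι] (S : Module.End K V)
    (T : Module.End K W) (ζ : ι → K) (hinj : Function.Injective ζ)
    (hT : ⨆ z, T.maxGenEigenspace z = ⊤) :
    Function.Surjective (restrictIntertwiners S T ζ) := by
  classical
  intro ψ
  have hint : DirectSum.IsInternal T.maxGenEigenspace :=
    DirectSum.isInternal_submodule_of_iSupIndep_of_iSup_eq_top T.independent_maxGenEigenspace hT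
  let e := LinearEquiv.ofBijective (DirectSum.coeLinearMap T.maxGenEigenspace) hint
  -- Projection onto the `z`-component of the decomposition.
  let π : (z : K) → W →ₗ[K] T.maxGenEigenspace z := fun z =>
    DirectSum.component K K (fun z => T.maxGenEigenspace z) z ∘ₗ e.symm.toLinearMap
  have he : ∀ z (x : T.maxGenEigenspace z), e.symm (x : W) =
      DirectSum.lof K K (fun z => T.maxGenEigenspace z) z x := by
    intro z x
    rw [LinearEquiv.symm_apply_eq]
    exact (DirectSum.coeLinearMap_lof T.maxGenEigenspace z x).symm
  have hπ : ∀ z (x : T.maxGenEigenspace z), π z x = x := by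
    intro z x
    simp only [π, LinearMap.comp_apply, LinearEquiv.coe_coe, he]
    exact DirectSum.component.lof_self _ _ _
  have hπ' : ∀ z z' (x : T.maxGenEigenspace z), z ≠ z' → π z' x = 0 := by
    intro z z' x hz
    simp only [π, LinearMap.comp_apply, LinearEquiv.coe_coe, he]
    exact DirectSum.of_eq_of_ne _ _ _ hz.symm
  let φ : W →ₗ[K] V := ∑ i, (S.maxGenEigenspace (ζ i)).subtype ∘ₗ (ψ i).1 ∘ₗ π (ζ i)
  have hφ : ∀ i (x : T.maxGenEigenspace (ζ i)), φ x = (ψ i).1 x := by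
    intro i x
    simp only [φ, LinearMap.sum_apply, LinearMap.comp_apply]
    rw [Finset.sum_eq_single i, hπ]
    · rfl
    · intro j _ hj
      rw [hπ' _ _ _ (hinj.ne hj.symm), map_zero, map_zero]
    · simp
  have hφ' : ∀ z (x : T.maxGenEigenspace z), z ∉ Set.range ζ → φ x = 0 := by
    intro z x hz
    simp only [φ, LinearMap.sum_apply, LinearMap.comp_apply]
    refine Finset.sum_eq_zero fun i _ => ?_
    rw [hπ' _ _ _ fun h => hz ⟨i, h.symm⟩, map_zero, map_zero]
  have hmem : φ ∈ intertwiners S T := by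
    rw [mem_intertwiners, ← sub_eq_zero, ← LinearMap.ker_eq_top, eq_top_iff, ← hT]
    refine iSup_le fun z x hx => ?_
    rw [LinearMap.mem_ker, LinearMap.sub_apply, sub_eq_zero, LinearMap.comp_apply,
      LinearMap.comp_apply]
    -- `T x` stays in the same generalized eigenspace, so the formulas for `φ` apply to it as well
    -- as to `x`.
    have hTx : T x = (restrictGenEigenspace T z ⟨x, hx⟩ : W) := rfl
    rw [hTx]
    by_cases hz : z ∈ Set.range ζ
    · obtain ⟨i, rfl⟩ := hz
      rw [hφ i, show φ x = _ from hφ i ⟨x, hx⟩]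
      exact congrArg Subtype.val (LinearMap.congr_fun (mem_intertwiners.1 (ψ i).2) ⟨x, hx⟩)
    · rw [hφ' z _ hz, show φ x = _ from hφ' z ⟨x, hx⟩ hz, map_zero]
  refine ⟨⟨φ, hmem⟩, funext fun i => Subtype.ext (LinearMap.ext fun x => Subtype.ext ?_)⟩
  exact hφ i x

/-! ### Eigenvalues as roots, and the final count. -/

/-- Off the roots, `A - z` is injective, hence so are its powers, and none of them kills a nonzero
vector. -/
theorem maxGenEigenspace_toLin'_eq_bot {K n : Type*} [Field K] [Fintype n] [DecidableEq n]
    (A : Matrix n n K) {z : K} (hz : ¬ A.charpoly.IsRoot z) :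
    Module.End.maxGenEigenspace (Matrix.toLin' A) z = ⊥ := by
  rw [← Matrix.charpoly_toLin', ← Module.End.hasEigenvalue_iff_isRoot_charpoly,
    Module.End.hasEigenvalue_iff, not_not, Module.End.eigenspace_def, LinearMap.ker_eq_bot] at hz
  refine (Submodule.eq_bot_iff _).2 fun x hx => ?_
  obtain ⟨k, hk⟩ := Module.End.mem_maxGenEigenspace _ _ _ |>.1 hx
  have hinj := hz.iterate k
  rw [← Module.End.coe_pow] at hinj
  exact hinj (hk.trans (map_zero _).symm)

/-- Over an algebraically closed field, the dimension of an intertwining code is the sum of the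
contributions of the common eigenvalues. -/
theorem finrank_intertwiningCode_eq_sum {K ι m n : Type*} [Field K] [IsAlgClosed K] [Fintype ι]
    [Fintype m] [DecidableEq m] [Fintype n] [DecidableEq n] (A : Matrix m m K) (B : Matrix n n K)
    (ζ : ι → K) (hinj : Function.Injective ζ)
    (hζ : ∀ z, A.charpoly.IsRoot z → B.charpoly.IsRoot z → z ∈ Set.range ζ) (a b : ι → ℕ)
    (α : (i : ι) → (a i).Partition) (β : (i : ι) → (b i).Partition)
    (hα : ∀ i, IsJordanPartition A (ζ i) (α i)) (hβ : ∀ i, IsJordanPartition B (ζ i) (β i)) :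
    finrank K (intertwiningCode A B) =
      ∑ i, finrank K (intertwiningCode (nilpotentMatrix K (α i)) (nilpotentMatrix K (β i))) := by
  let S : Module.End K (m → K) := Matrix.toLin' A
  let T : Module.End K (n → K) := Matrix.toLin' B
  have htop : ⨆ z, T.maxGenEigenspace z = ⊤ := Module.End.iSup_maxGenEigenspace_eq_top T
  have hbot : ∀ z ∉ Set.range ζ, S.maxGenEigenspace z = ⊥ ∨ T.maxGenEigenspace z = ⊥ := by
    intro z hz
    by_contra! h
    exact hz (hζ z (not_imp_comm.1 (maxGenEigenspace_toLin'_eq_bot A) h.1)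
      (not_imp_comm.1 (maxGenEigenspace_toLin'_eq_bot B) h.2))
  have hcode : finrank K (intertwiners S T) = finrank K (intertwiningCode A B) := by
    rw [finrank_intertwiners_eq_intertwiningCode (Pi.basisFun K m) (Pi.basisFun K n)]
    have hA : LinearMap.toMatrix (Pi.basisFun K m) (Pi.basisFun K m) S = A :=
      LinearMap.toMatrix'_toLin' A
    have hB : LinearMap.toMatrix (Pi.basisFun K n) (Pi.basisFun K n) T = B :=
      LinearMap.toMatrix'_toLin' B
    rw [hA, hB]
  rw [← hcode, (LinearEquiv.ofBijective (restrictIntertwiners S T ζ)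
    ⟨restrictIntertwiners_injective S T ζ htop hbot,
      restrictIntertwiners_surjective S T ζ hinj htop⟩).finrank_eq, Module.finrank_pi_fintype]
  refine Finset.sum_congr rfl fun i _ => ?_
  obtain ⟨v, hv⟩ := hα i
  obtain ⟨w, hw⟩ := hβ i
  rw [finrank_intertwiners_eq_intertwiningCode v w, hv, hw, intertwiningCode_scalar_add]

theorem theorem2p7 {F : Type*} [Field F] [DecidableEq F] (r s : ℕ)
    (A : Matrix (Fin r) (Fin r) F) (B : Matrix (Fin s) (Fin s) F)
    (m : ℕ) (ζ : Fin m → AlgebraicClosure F) (hζ : Function.Injective ζ)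
    (hroots : Set.range ζ =
      {z | Polynomial.aeval z (EuclideanDomain.gcd A.charpoly B.charpoly) = 0})
    (a b : Fin m → ℕ) (α : (i : Fin m) → (a i).Partition) (β : (i : Fin m) → (b i).Partition)
    (hα : ∀ i, IsJordanPartition (A.map (algebraMap F (AlgebraicClosure F))) (ζ i) (α i))
    (hβ : ∀ i, IsJordanPartition (B.map (algebraMap F (AlgebraicClosure F))) (ζ i) (β i)) :
    Module.finrank F (intertwiningCode A B) =
      ∑ i : Fin m, Module.finrank F
        (intertwiningCode (nilpotentMatrix F (α i)) (nilpotentMatrix F (β i))) := by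
  rw [← finrank_intertwiningCode_map (AlgebraicClosure F) A B,
    finrank_intertwiningCode_eq_sum _ _ ζ hζ ?_ a b α β hα hβ]
  · refine Finset.sum_congr rfl fun i _ => ?_
    -- Each summand descends from the closure to `F`, where the nilpotent matrices are already
    -- defined.
    rw [← finrank_intertwiningCode_map (AlgebraicClosure F) (nilpotentMatrix F (α i)),
      nilpotentMatrix_map, nilpotentMatrix_map]
  · intro z h1 h2
    rw [Matrix.charpoly_map, Polynomial.IsRoot.def, Polynomial.eval_map] at h1 h2
    rw [hroots]
    -- The gcd is a polynomial combination of the two characteristic polynomials, so it vanishes at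
    -- their common roots.
    exact Polynomial.eval₂_gcd_eq_zero h1 h2
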